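/- **Setting.** For a permutation $\tau$ of $\{1,2,3\}$, one step of the Rauzy induction on lengths $l_{\tau(1)}>l_{\tau(2)}>l_{\tau(3)}>0$ replaces the longest one, the winner $l_{\tau(1)}$, by $l_{\tau(1)}-l_{\tau(2)}-l_{\tau(3)}$. The accelerated induction performs $n\ge 1$ such steps with the same order $\tau$ during them, the order changing at the end; the new order is then $(\tau(2),\tau(1),\tau(3))$ or $(\tau(2),\tau(3),\tau(1))$. These are the arrows $\tau\to\tau'$ of the adjusted accelerated Rauzy graph. The associated countable Markov shift $\sigma$ acts on sequences $x=(\tau_k,n_k)_{k\ge0}$ of states $(\tau_k,n_k)\in S_3\times\mathbb N_{\ge1}$ such that every $\tau_k\to\tau_{k+1}$ is an arrow. The cocycle matrix $B_\delta$ of a finite path $\delta$ is the product (the latest factor on the left) of the matrices of its states, where the matrix of $(\tau,n)$ adds $n$ times row $\tau(1)$ to the two other rows. Let $\gamma_*$ be a finite path $(\tau_1,n_1)\to\dots\to(\tau_k,n_k)\to\tau_{k+1}$ that is complete: each of $1,2,3$ is the winner of one of its arrows. Let $\Delta_{\gamma_*}$ be the set of infinite paths that begin with $\gamma_*$, and let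 $\Sigma$ be the set of the infinite paths $x$ such that $\sigma^m x\in\Delta_{\gamma_*}$ for infinitely many $m$. Each $x\in\Sigma$ codes exactly one length vector $\lambda(x)$ with $\lambda_1+\lambda_2+\lambda_3=1$. The roof function is the first return time to $\Delta_{\gamma_*}$, $$r(x)=-\log\big\|(B_\delta^{T})^{-1}\lambda(x)\big\|_1 ,$$ where $\delta$ is the path that $x$ follows until the first time $m\ge1$ with $\sigma^m x\in\Delta_{\gamma_*}$. For a map $F:X\to X$ and a potential $\phi:X\to\mathbb R$, the Ruelle operator is $L_\phi f(x)=\sum_{y\in X,\,F(y)=x}e^{\phi(y)}f(y)$. **Theorem.** Let $\gamma_*$ be a complete path and $\phi=-3r$. Then $\|L_\phi 1\|_\infty<+\infty$, that is, the series defining $L_\phi1(x)$ converges for every $x$ and $L_\phi 1$ is a bounded function, both 1. for the Ruelle operator of the Markov shift $\sigma$ on $\Sigma$, and 2. for the Ruelle operator of the first return map of $\sigma$ to $\Delta_{\gamma_*}$, on $\Sigma\cap\Delta_{\gamma_*}$. -/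

import Mathlib

open scoped Matrix

namespace RauzyGasket

/-! ### The adjusted accelerated Rauzy graph and its countable Markov shift -/

/-- A state of the countable Markov shift: a permutation `τ`, recording the order
`l (τ 0) > l (τ 1) > l (τ 2)` of the three lengths (so `τ 0` is the winner), and the number `n ≥ 1`
of ordinary induction steps contained in the corresponding accelerated step. -/
abbrev State : Type := Equiv.Perm (Fin 3) × ℕ+

/-- The arrows of the adjusted accelerated Rauzy graph. At the end of an accelerated step the former
longest interval `τ 0` has become the second one, `(τ 1, τ 0, τ 2)`, or the shortest one,
`(τ 1, τ 2, τ 0)`. -/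
def Arrow (τ τ' : Equiv.Perm (Fin 3)) : Prop :=
  τ' = τ * Equiv.swap 0 1 ∨ τ' = τ * finRotate 3

/-- The infinite admissible paths (the points of the countable Markov shift). -/
def pathSpace : Set (ℕ → State) :=
  {x | ∀ k, Arrow (x k).1 (x (k + 1)).1}

/-- The shift `σ`. -/
def shift (x : ℕ → State) : ℕ → State := fun k => x (k + 1)

/-! ### Rauzy induction and the coding of length vectors -/

/-- One step of the Rauzy induction, for lengths ordered by `τ`: the sum of the two shorter lengths
is subtracted from the longest one. Intervals keep their original numbers. -/
def rauzyStep (τ : Equiv.Perm (Fin 3)) (v : Fin 3 → ℝ) : Fin 3 → ℝ :=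
  Function.update v (τ 0) (v (τ 0) - v (τ 1) - v (τ 2))

/-- The (not renormalised) lengths after the first `k` accelerated steps prescribed by `x`. -/
def lengthsAfter (x : ℕ → State) (l : Fin 3 → ℝ) : ℕ → Fin 3 → ℝ
  | 0 => l
  | k + 1 => (rauzyStep (x k).1)^[((x k).2 : ℕ)] (lengthsAfter x l k)

/-- The positive lengths `v` are in the strict order recorded by `τ`. -/
def OrderedBy (τ : Equiv.Perm (Fin 3)) (v : Fin 3 → ℝ) : Prop :=
  v (τ 1) < v (τ 0) ∧ v (τ 2) < v (τ 1) ∧ 0 < v (τ 2)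

/-- The normalised length vector `l` has the path `x` as its symbolic dynamics under the accelerated
Rauzy induction. (Inside the `k`-th accelerated step the order is then `(x k).1` throughout.) -/
def Codes (x : ℕ → State) (l : Fin 3 → ℝ) : Prop :=
  (∑ i, l i = 1) ∧ ∀ k, OrderedBy (x k).1 (lengthsAfter x l k)

/-- The length vector `λ` of the point `x` of the Markov shift: the one coded by `x`. It exists and
is unique for every path that runs through a given complete path infinitely often. -/
noncomputable def lengthVector (x : ℕ → State) : Fin 3 → ℝ :=
  Classical.epsilon (Codes x)

/-! ### The standard cocycle -/

/-- The cocycle matrix of the state `(τ, n)`: `n` times the row of the winner `τ 0` is added to the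
two other rows. -/
def stateMatrix (j : State) : Matrix (Fin 3) (Fin 3) ℝ :=
  Matrix.of fun i k => if i = k then 1 else if k = j.1 0 then ((j.2 : ℕ) : ℝ) else 0

/-- The cocycle matrix `B_γ` of the path `γ` formed by the first `m` accelerated steps of `x`. -/
def cocycle (x : ℕ → State) : ℕ → Matrix (Fin 3) (Fin 3) ℝ
  | 0 => 1
  | m + 1 => stateMatrix (x m) * cocycle x m

/-! ### The section `Δ_γ`, first returns, and the roof function -/

/-- A finite path: its successive states `(τ₁, n₁), …, (τₖ, nₖ)` and its final vertex `τₖ₊₁`. -/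
structure FinitePath where
  /-- the states, one for each arrow of the path -/
  states : List State
  /-- the final vertex -/
  last : Equiv.Perm (Fin 3)
  /-- consecutive vertices are joined by arrows -/
  chain : List.IsChain Arrow (states.map Prod.fst ++ [last])

/-- A path is complete if each of the three intervals is the winner of one of its arrows. -/
def FinitePath.Complete (γ : FinitePath) : Prop :=
  ∀ α : Fin 3, ∃ j ∈ γ.states, j.1 0 = α

/-- The subsimplex `Δ_γ`, in symbolic terms: the infinite paths that begin with `γ`. -/
def FinitePath.simplex (γ : FinitePath) : Set (ℕ → State) :=
  {x | (∀ (i : ℕ) (h : i < γ.states.length), x i = γ.states[i]) ∧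
    (x γ.states.length).1 = γ.last}

/-- The points of the Markov shift whose orbit visits `Δ_γ` infinitely often, i.e. those for which
all successive return times to `Δ_γ` are defined. -/
def FinitePath.recurrent (γ : FinitePath) : Set (ℕ → State) :=
  {x | x ∈ pathSpace ∧ ∀ N, ∃ n, N ≤ n ∧ shift^[n] x ∈ γ.simplex}

/-- The number of iterations of `σ` up to the first return to `Δ_γ` (the first visit at a positive
time). -/
noncomputable def FinitePath.returnIndex (γ : FinitePath) (x : ℕ → State) : ℕ :=
  sInf {n | 1 ≤ n ∧ shift^[n] x ∈ γ.simplex}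

/-- The first return map to `Δ_γ`. -/
noncomputable def FinitePath.returnMap (γ : FinitePath) (x : ℕ → State) : ℕ → State :=
  shift^[γ.returnIndex x] x

/-- The roof function, the first return time to `Δ_γ`: `r = -log ‖(B_δᵀ)⁻¹ λ‖₁`, where `δ` is the path
followed until the first return. -/
noncomputable def FinitePath.roof (γ : FinitePath) (x : ℕ → State) : ℝ :=
  -Real.log (∑ i, |(((cocycle x (γ.returnIndex x))ᵀ)⁻¹ *ᵥ lengthVector x) i|)

/-! ### The Ruelle operator -/

/-- The terms `e^{φ(y)} f(y)`, `F y = x`, of the Ruelle operator of the map `F` on the space `X`. -/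
noncomputable def ruelleTerm {Ω : Type*} (X : Set Ω) (F : Ω → Ω) (φ f : Ω → ℝ) (x : Ω) :
    {y : Ω // y ∈ X ∧ F y = x} → ℝ :=
  fun y => Real.exp (φ y) * f y

/-- The Ruelle operator `L_φ f (x) = ∑_{F y = x} e^{φ(y)} f(y)` of the map `F` on the space `X`. -/
noncomputable def ruelle {Ω : Type*} (X : Set Ω) (F : Ω → Ω) (φ f : Ω → ℝ) (x : Ω) : ℝ :=
  ∑' y, ruelleTerm X F φ f x y

/-- `‖L_φ f‖_∞ < ∞` on `X`: the series defining `L_φ f` converges at every point of `X`, and its sum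
is a bounded function. -/
def RuelleBounded {Ω : Type*} (X : Set Ω) (F : Ω → Ω) (φ f : Ω → ℝ) : Prop :=
  (∀ x ∈ X, Summable (ruelleTerm X F φ f x)) ∧ ∃ C : ℝ, ∀ x ∈ X, |ruelle X F φ f x| ≤ C

end RauzyGasket

/-!
The key fact about the roof function `r` is that `e^{-r(x)}` is the total length left at the first
return. If `δ` is the path followed until then, the length vector `λ(x)` of total length `1` is
recovered from the lengths `v` at the return as `B_δᵀ v`.

The length vector exists for every path that runs through `γ` infinitely often
(`FinitePath.exists_codes`). Compactness yields a vector whose lengths stay nonnegative.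
Completeness of `γ` makes them positive, since an interval that wins is at least as long before the
accelerated step as all the intervals together after it. Positive lengths are automatically in the
prescribed order, because undoing a step makes the winner the longest interval, and the second
interval of a step is the winner of the next one.

For the shift, a preimage of `x` adds one state `(τ, n)` in front of `x`. The longest interval after
this accelerated step was removed `n` times from the winner, so at most `3 / n` of the total length
is left, and `∑ (3 / n) ^ 3` converges.

For the first return map the exponent `3` is critical, and the bound is a volume estimate. On `Δ_γ`
all coordinates are comparable, so `e^{-r(y)}` is at most a constant, depending on `γ` only, times
the inverse of the norm of the matrix of the path `δγ`
(`FinitePath.sum_lengthsAfter_returnIndex_le`). This matrix has determinant `1`; its transpose,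
divided by its norm, maps a fixed open set into the unit cube, and the volume of the image is the
inverse cube of the norm, up to a fixed factor. The images for different preimages `y` of the same
point are disjoint, since the lengths determine the itinerary (`eq_of_orderedBy`) and a first return
path followed by `γ` cannot begin with another one followed by `γ`
(`FinitePath.disjoint_cell`). Hence their volumes add up to at most `1`.
-/

open MeasureTheory

namespace RauzyGasket

/-! ### One accelerated step -/

lemma sum_eq_of_perm (τ : Equiv.Perm (Fin 3)) (v : Fin 3 → ℝ) :
    ∑ i, v i = v (τ 0) + v (τ 1) + v (τ 2) := by
  rw [← Equiv.sum_comp τ v, Fin.sum_univ_three]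

lemma forall_of_perm {P : Fin 3 → Prop} (τ : Equiv.Perm (Fin 3)) (h0 : P (τ 0)) (h1 : P (τ 1))
    (h2 : P (τ 2)) (i : Fin 3) : P i := by
  obtain ⟨a, rfl⟩ := τ.surjective i
  fin_cases a <;> assumption

lemma iterate_rauzyStep (τ : Equiv.Perm (Fin 3)) (v : Fin 3 → ℝ) (n : ℕ) :
    (rauzyStep τ)^[n] v = Function.update v (τ 0) (v (τ 0) - n * (v (τ 1) + v (τ 2))) := by
  induction n with
  | zero => simp
  | succ n ih =>
    rw [Function.iterate_succ_apply', ih, rauzyStep]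
    simp only [Function.update_self, Function.update_idem, ne_eq, EmbeddingLike.apply_eq_iff_eq,
      one_ne_zero, not_false_eq_true, Function.update_of_ne, Fin.reduceEq]
    congr 1
    push_cast
    ring

lemma transpose_stateMatrix_mulVec (j : State) (w : Fin 3 → ℝ) :
    (stateMatrix j)ᵀ *ᵥ w =
      Function.update w (j.1 0) (w (j.1 0) + (j.2 : ℕ) * (w (j.1 1) + w (j.1 2))) := by
  ext i
  rw [Matrix.mulVec, dotProduct, sum_eq_of_perm j.1]
  refine forall_of_perm (P := fun i => (stateMatrix j)ᵀ i (j.1 0) * w (j.1 0) +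
    (stateMatrix j)ᵀ i (j.1 1) * w (j.1 1) + (stateMatrix j)ᵀ i (j.1 2) * w (j.1 2) =
      Function.update w (j.1 0) (w (j.1 0) + (j.2 : ℕ) * (w (j.1 1) + w (j.1 2))) i) j.1 ?_ ?_ ?_ i
  · simp [stateMatrix]
    ring
  all_goals simp [stateMatrix]

lemma transpose_stateMatrix_mulVec_iterate (j : State) (v : Fin 3 → ℝ) :
    (stateMatrix j)ᵀ *ᵥ ((rauzyStep j.1)^[(j.2 : ℕ)] v) = v := by
  rw [transpose_stateMatrix_mulVec, iterate_rauzyStep]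
  simp

lemma det_stateMatrix (j : State) : (stateMatrix j).det = 1 := by
  simp only [stateMatrix]
  generalize j.1 0 = a
  fin_cases a <;> simp [Matrix.det_fin_three]

lemma one_le_count (j : State) : (1 : ℝ) ≤ ((j.2 : ℕ) : ℝ) := by
  exact_mod_cast j.2.pos

/-- Along an arrow the old second interval becomes the winner. -/
lemma Arrow.apply_zero {τ τ' : Equiv.Perm (Fin 3)} (h : Arrow τ τ') : τ' 0 = τ 1 := by
  rcases h with rfl | rfl <;> simp

/-- Undoing an accelerated step makes the winner the longest interval, whatever the order of the
positive lengths was before. -/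
lemma transpose_stateMatrix_mulVec_lt_winner (j : State) {w : Fin 3 → ℝ} (hw : ∀ i, 0 < w i)
    {i : Fin 3} (hi : i ≠ j.1 0) :
    ((stateMatrix j)ᵀ *ᵥ w) i < ((stateMatrix j)ᵀ *ᵥ w) (j.1 0) := by
  have hn := one_le_count j
  rw [transpose_stateMatrix_mulVec, Function.update_self, Function.update_of_ne hi]
  have h0 := hw (j.1 0)
  have h1 := hw (j.1 1)
  have h2 := hw (j.1 2)
  have hmul : w (j.1 1) + w (j.1 2) ≤ (j.2 : ℕ) * (w (j.1 1) + w (j.1 2)) :=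
    le_mul_of_one_le_left (by positivity) hn
  revert hi
  refine forall_of_perm (P := fun i => i ≠ j.1 0 → w i < _) j.1 ?_ ?_ ?_ i
  · exact fun h => absurd rfl h
  all_goals intro _; linarith

lemma le_transpose_stateMatrix_mulVec (j : State) {w : Fin 3 → ℝ} (hw : ∀ i, 0 ≤ w i)
    (i : Fin 3) : w i ≤ ((stateMatrix j)ᵀ *ᵥ w) i := by
  rw [transpose_stateMatrix_mulVec]
  have h1 := hw (j.1 1)
  have h2 := hw (j.1 2)
  by_cases hi : i = j.1 0
  · subst hi
    rw [Function.update_self]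
    have : 0 ≤ ((j.2 : ℕ) : ℝ) * (w (j.1 1) + w (j.1 2)) := by positivity
    linarith
  · rw [Function.update_of_ne hi]

lemma sum_le_transpose_stateMatrix_mulVec_winner (j : State) {w : Fin 3 → ℝ}
    (hw : ∀ i, 0 ≤ w i) : ∑ i, w i ≤ ((stateMatrix j)ᵀ *ᵥ w) (j.1 0) := by
  rw [transpose_stateMatrix_mulVec, Function.update_self, sum_eq_of_perm j.1]
  have hmul : w (j.1 1) + w (j.1 2) ≤ (j.2 : ℕ) * (w (j.1 1) + w (j.1 2)) :=
    le_mul_of_one_le_left (add_nonneg (hw _) (hw _)) (one_le_count j)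
  linarith

lemma OrderedBy.pos {τ : Equiv.Perm (Fin 3)} {v : Fin 3 → ℝ} (h : OrderedBy τ v) (i : Fin 3) :
    0 < v i := by
  obtain ⟨h1, h2, h3⟩ := h
  refine forall_of_perm (P := fun i => 0 < v i) τ ?_ ?_ ?_ i <;> linarith

lemma OrderedBy.lt_winner {τ : Equiv.Perm (Fin 3)} {v : Fin 3 → ℝ} (h : OrderedBy τ v)
    {i : Fin 3} (hi : i ≠ τ 0) : v i < v (τ 0) := by
  obtain ⟨h1, h2, h3⟩ := h
  revert hi
  refine forall_of_perm (P := fun i => i ≠ τ 0 → v i < v (τ 0)) τ ?_ ?_ ?_ i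
  · exact fun h => absurd rfl h
  all_goals intro _; linarith

lemma OrderedBy.le_winner {τ : Equiv.Perm (Fin 3)} {v : Fin 3 → ℝ} (h : OrderedBy τ v)
    (i : Fin 3) : v i ≤ v (τ 0) := by
  by_cases hi : i = τ 0
  · rw [hi]
  · exact (h.lt_winner hi).le

lemma OrderedBy.unique {τ τ' : Equiv.Perm (Fin 3)} {v : Fin 3 → ℝ} (h : OrderedBy τ v)
    (h' : OrderedBy τ' v) : τ = τ' := by
  have anti : ∀ {τ : Equiv.Perm (Fin 3)}, OrderedBy τ v → StrictAnti (v ∘ τ) := by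
    intro τ h
    rw [Fin.strictAnti_iff_succ_lt]
    intro i
    fin_cases i
    exacts [h.1, h.2.1]
  have key : StrictMono (τ'⁻¹ * τ : Equiv.Perm (Fin 3)) := by
    intro a b hab
    have h1 := anti h hab
    by_contra hcon
    have h2 := (anti h').antitone (not_lt.1 hcon)
    simp at h1 h2
    linarith
  have rigid : ∀ ρ : Equiv.Perm (Fin 3), ρ 0 < ρ 1 → ρ 1 < ρ 2 → ρ = 1 := by decide
  exact (inv_mul_eq_one.1 (rigid _ (key (by decide)) (key (by decide)))).symm

/-- Undoing an accelerated step, for positive lengths in which the old second interval is longer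
than the old third one. -/
lemma orderedBy_transpose_stateMatrix_mulVec (j : State) {w : Fin 3 → ℝ} (hw : ∀ i, 0 < w i)
    (h : w (j.1 2) < w (j.1 1)) : OrderedBy j.1 ((stateMatrix j)ᵀ *ᵥ w) := by
  refine ⟨transpose_stateMatrix_mulVec_lt_winner j hw (by simp), ?_, ?_⟩
  · rw [transpose_stateMatrix_mulVec]
    simpa using h
  · exact (hw _).trans_le (le_transpose_stateMatrix_mulVec j (fun i => (hw i).le) _)

/-- The number of ordinary steps is determined by the lengths before the accelerated step: one step
fewer leaves the winner too long to lose its first place. -/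
lemma count_unique {τ τ₁ τ₂ : Equiv.Perm (Fin 3)} {n₁ n₂ : ℕ} {v : Fin 3 → ℝ}
    (h₁ : Arrow τ τ₁) (h₂ : Arrow τ τ₂)
    (ho₁ : OrderedBy τ₁ ((rauzyStep τ)^[n₁] v)) (ho₂ : OrderedBy τ₂ ((rauzyStep τ)^[n₂] v)) :
    n₁ = n₂ := by
  wlog hlt : n₁ < n₂ generalizing n₁ n₂ τ₁ τ₂
  · rcases lt_trichotomy n₁ n₂ with h | h | h
    · exact absurd h hlt
    · exact h
    · exact (this h₂ h₁ ho₂ ho₁ h).symm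
  exfalso
  have hle : (n₁ : ℝ) + 1 ≤ n₂ := by exact_mod_cast hlt
  have hw := ho₁.le_winner (τ 0)
  have hp0 := ho₂.pos (τ 0)
  have hp1 := ho₂.pos (τ 1)
  have hp2 := ho₂.pos (τ 2)
  rw [h₁.apply_zero] at hw
  simp only [iterate_rauzyStep, Function.update_self, ne_eq, EmbeddingLike.apply_eq_iff_eq,
    one_ne_zero, not_false_eq_true, Function.update_of_ne, Fin.reduceEq] at hw hp0 hp1 hp2
  have := mul_le_mul_of_nonneg_right hle (add_pos hp1 hp2).le
  linarith

/-! ### The cocycle and the lengths along a path -/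

lemma transpose_stateMatrix_mulVec_lengthsAfter (x : ℕ → State) (l : Fin 3 → ℝ) (k : ℕ) :
    (stateMatrix (x k))ᵀ *ᵥ lengthsAfter x l (k + 1) = lengthsAfter x l k :=
  transpose_stateMatrix_mulVec_iterate _ _

lemma transpose_cocycle_mulVec_lengthsAfter (x : ℕ → State) (l : Fin 3 → ℝ) (k : ℕ) :
    (cocycle x k)ᵀ *ᵥ lengthsAfter x l k = l := by
  induction k with
  | zero => simp [cocycle, lengthsAfter]
  | succ k ih =>
    rw [cocycle, Matrix.transpose_mul, ← Matrix.mulVec_mulVec,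
      transpose_stateMatrix_mulVec_lengthsAfter, ih]

lemma det_cocycle (x : ℕ → State) (k : ℕ) : (cocycle x k).det = 1 := by
  induction k with
  | zero => simp [cocycle]
  | succ k ih => simp [cocycle, det_stateMatrix, ih]

lemma lengthsAfter_eq (x : ℕ → State) (l : Fin 3 → ℝ) (k : ℕ) :
    lengthsAfter x l k = ((cocycle x k)ᵀ)⁻¹ *ᵥ l := by
  have hdet : IsUnit ((cocycle x k)ᵀ).det := by
    rw [Matrix.det_transpose, det_cocycle]
    exact isUnit_one
  conv_rhs => rw [← transpose_cocycle_mulVec_lengthsAfter x l k]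
  rw [Matrix.mulVec_mulVec, Matrix.nonsing_inv_mul _ hdet, Matrix.one_mulVec]

lemma lengthsAfter_transpose_cocycle_mulVec (x : ℕ → State) (w : Fin 3 → ℝ) (k : ℕ) :
    lengthsAfter x ((cocycle x k)ᵀ *ᵥ w) k = w := by
  have hdet : IsUnit ((cocycle x k)ᵀ).det := by
    rw [Matrix.det_transpose, det_cocycle]
    exact isUnit_one
  rw [lengthsAfter_eq, Matrix.mulVec_mulVec, Matrix.nonsing_inv_mul _ hdet, Matrix.one_mulVec]

lemma one_apply_nonneg (i k : Fin 3) : 0 ≤ (1 : Matrix (Fin 3) (Fin 3) ℝ) i k := by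
  rw [Matrix.one_apply]
  split_ifs <;> norm_num

lemma one_le_cocycle (x : ℕ → State) (m : ℕ) (i k : Fin 3) :
    (1 : Matrix (Fin 3) (Fin 3) ℝ) i k ≤ cocycle x m i k := by
  induction m generalizing i k with
  | zero => rfl
  | succ m ih =>
    have hnn : ∀ a b, 0 ≤ cocycle x m a b := fun a b =>
      (one_apply_nonneg a b).trans (ih a b)
    refine (ih i k).trans ?_
    rw [cocycle, Matrix.mul_apply]
    calc cocycle x m i k = stateMatrix (x m) i i * cocycle x m i k := by simp [stateMatrix]
      _ ≤ _ := Finset.single_le_sum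
        (f := fun a => stateMatrix (x m) i a * cocycle x m a k) (fun a _ => mul_nonneg ?_ (hnn a k))
        (Finset.mem_univ i)
    simp only [stateMatrix, Matrix.of_apply]
    split_ifs <;> positivity

lemma cocycle_nonneg (x : ℕ → State) (m : ℕ) (i k : Fin 3) : 0 ≤ cocycle x m i k :=
  (one_apply_nonneg i k).trans (one_le_cocycle x m i k)

lemma shift_iterate_apply (x : ℕ → State) (m k : ℕ) : shift^[m] x k = x (m + k) := by
  induction m generalizing k with
  | zero => simp
  | succ m ih => rw [Function.iterate_succ_apply', shift, ih]; congr 1; ring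

lemma cocycle_add (x : ℕ → State) (m k : ℕ) :
    cocycle x (m + k) = cocycle (shift^[m] x) k * cocycle x m := by
  induction k with
  | zero => simp [cocycle]
  | succ k ih => rw [← add_assoc, cocycle, cocycle, ih, shift_iterate_apply, Matrix.mul_assoc]

lemma cocycle_congr {x y : ℕ → State} {m : ℕ} (h : ∀ k < m, x k = y k) :
    cocycle x m = cocycle y m := by
  induction m with
  | zero => rfl
  | succ m ih =>
    rw [cocycle, cocycle, h m m.lt_succ_self, ih fun k hk => h k (hk.trans m.lt_succ_self)]

lemma lengthsAfter_congr {x y : ℕ → State} {m : ℕ} (h : ∀ k < m, x k = y k) (l : Fin 3 → ℝ) :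
    lengthsAfter x l m = lengthsAfter y l m := by
  rw [lengthsAfter_eq, lengthsAfter_eq, cocycle_congr h]

/-- Lengths that are nonnegative at some time were nonnegative, and at least as large, before. -/
lemma lengthsAfter_le_of_le {x : ℕ → State} {l : Fin 3 → ℝ} {k m : ℕ} (hkm : k ≤ m)
    (h : ∀ i, 0 ≤ lengthsAfter x l m i) (i : Fin 3) :
    lengthsAfter x l m i ≤ lengthsAfter x l k i := by
  induction hkm with
  | refl => rfl
  | @step m hkm ih =>
    have hstep := fun i => le_transpose_stateMatrix_mulVec (x m) h i
    rw [transpose_stateMatrix_mulVec_lengthsAfter] at hstep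
    exact (hstep i).trans (ih fun i => (h i).trans (hstep i))

/-- If every interval wins between the times `k` and `m`, then at time `k` every interval is at
least as long as all the intervals together at time `m`. -/
lemma sum_le_lengthsAfter {x : ℕ → State} {l : Fin 3 → ℝ} {k m : ℕ}
    (h : ∀ i, 0 ≤ lengthsAfter x l m i) (hwin : ∀ α, ∃ j, k ≤ j ∧ j < m ∧ (x j).1 0 = α)
    (α : Fin 3) : ∑ i, lengthsAfter x l m i ≤ lengthsAfter x l k α := by
  obtain ⟨j, hkj, hjm, rfl⟩ := hwin α
  have hmono := fun i => lengthsAfter_le_of_le (x := x) (l := l) (Nat.succ_le_of_lt hjm) h i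
  have hnn : ∀ i, 0 ≤ lengthsAfter x l (j + 1) i := fun i => (h i).trans (hmono i)
  calc ∑ i, lengthsAfter x l m i ≤ ∑ i, lengthsAfter x l (j + 1) i :=
        Finset.sum_le_sum fun i _ => hmono i
    _ ≤ lengthsAfter x l j ((x j).1 0) := by
        rw [← transpose_stateMatrix_mulVec_lengthsAfter x l j]
        exact sum_le_transpose_stateMatrix_mulVec_winner _ hnn
    _ ≤ lengthsAfter x l k ((x j).1 0) := by
        refine lengthsAfter_le_of_le hkj (fun i => ?_) _
        exact (h i).trans (lengthsAfter_le_of_le hjm.le h i)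

/-- The order of the lengths at some time forces the prescribed order at all earlier times. -/
lemma orderedBy_of_le {x : ℕ → State} (hx : x ∈ pathSpace) {l : Fin 3 → ℝ} {k m : ℕ} (hkm : k ≤ m)
    (h : OrderedBy (x m).1 (lengthsAfter x l m)) : OrderedBy (x k).1 (lengthsAfter x l k) := by
  induction hkm with
  | refl => exact h
  | @step m hkm ih =>
    apply ih
    rw [← transpose_stateMatrix_mulVec_lengthsAfter x l m]
    have hwinner := (hx m).apply_zero
    refine orderedBy_transpose_stateMatrix_mulVec _ h.pos ?_
    rw [← hwinner]
    exact h.lt_winner (by simp [hwinner])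

/-- The lengths determine the itinerary: two paths that both prescribe the correct orders up to the
times `m ≤ m'` agree up to time `m`. -/
lemma eq_of_orderedBy {x y : ℕ → State} (hx : x ∈ pathSpace) (hy : y ∈ pathSpace)
    {l : Fin 3 → ℝ} {m m' : ℕ} (hmm : m ≤ m')
    (hox : OrderedBy (x m).1 (lengthsAfter x l m))
    (hoy : OrderedBy (y m').1 (lengthsAfter y l m')) :
    (∀ k < m, x k = y k) ∧ (x m).1 = (y m).1 := by
  have vertex : ∀ k ≤ m, (∀ i < k, x i = y i) → (x k).1 = (y k).1 := by
    intro k hk hi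
    have h1 := orderedBy_of_le hx hk hox
    have h2 := orderedBy_of_le hy (hk.trans hmm) hoy
    rw [lengthsAfter_congr hi] at h1
    exact h1.unique h2
  have main : ∀ k ≤ m, ∀ i < k, x i = y i := by
    intro k
    induction k with
    | zero => simp
    | succ k ih =>
      intro hk i hik
      have ih := ih (by omega)
      rcases Nat.lt_succ_iff_lt_or_eq.1 hik with h | rfl
      · exact ih i h
      have hv := vertex i (by omega) ih
      refine Prod.ext hv (PNat.coe_injective ?_)
      have h1 := orderedBy_of_le hx hk hox
      have h2 := orderedBy_of_le hy (hk.trans hmm) hoy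
      rw [lengthsAfter, lengthsAfter_congr ih, hv] at h1
      exact count_unique (hv ▸ hx i) (hy i) h1 h2
  exact ⟨main m le_rfl, vertex m le_rfl (main m le_rfl)⟩

/-! ### Existence of the coded length vector -/

lemma FinitePath.exists_winner {γ : FinitePath} (hγ : γ.Complete) {x : ℕ → State}
    (hx : x ∈ γ.simplex) (α : Fin 3) : ∃ j < γ.states.length, (x j).1 0 = α := by
  obtain ⟨s, hs, rfl⟩ := hγ α
  obtain ⟨j, hj, rfl⟩ := List.mem_iff_getElem.1 hs
  exact ⟨j, hj, by rw [hx.1 j hj]⟩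

lemma FinitePath.exists_winner_of_shift {γ : FinitePath} (hγ : γ.Complete) {x : ℕ → State} {m : ℕ}
    (hx : shift^[m] x ∈ γ.simplex) (α : Fin 3) :
    ∃ j, m ≤ j ∧ j < m + γ.states.length ∧ (x j).1 0 = α := by
  obtain ⟨j, hj, h⟩ := γ.exists_winner hγ hx α
  rw [shift_iterate_apply] at h
  exact ⟨m + j, by omega, by omega, h⟩

/-- Along a path that runs through a complete path infinitely often, lengths that stay nonnegative
are in fact positive and in the prescribed order. -/
lemma FinitePath.codes_of_nonneg {γ : FinitePath} (hγ : γ.Complete) {x : ℕ → State}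
    (hx : x ∈ γ.recurrent) {l : Fin 3 → ℝ} (hl : ∑ i, l i = 1)
    (h : ∀ k i, 0 ≤ lengthsAfter x l k i) : Codes x l := by
  have hsum : ∀ m, 0 < ∑ i, lengthsAfter x l m i := by
    intro m
    refine (Finset.sum_nonneg fun i _ => h m i).lt_of_ne fun h0 => ?_
    have hz : lengthsAfter x l m = 0 := by
      funext i
      exact (Finset.sum_eq_zero_iff_of_nonneg fun i _ => h m i).1 h0.symm i (Finset.mem_univ i)
    have := transpose_cocycle_mulVec_lengthsAfter x l m
    rw [hz, Matrix.mulVec_zero] at this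
    simp [← this] at hl
  have hpos : ∀ k i, 0 < lengthsAfter x l k i := by
    intro k i
    obtain ⟨n, hkn, hn⟩ := hx.2 k
    refine (hsum (n + γ.states.length)).trans_le (sum_le_lengthsAfter (h _) (fun α => ?_) i)
    obtain ⟨j, hj, hj', hα⟩ := γ.exists_winner_of_shift hγ hn α
    exact ⟨j, hkn.trans hj, hj', hα⟩
  refine ⟨hl, fun k => ?_⟩
  rw [← transpose_stateMatrix_mulVec_lengthsAfter x l k]
  refine orderedBy_transpose_stateMatrix_mulVec _ (hpos _) ?_
  -- the second interval of step `k` is the winner of step `k + 1`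
  have hw := (hx.1 k).apply_zero
  rw [← hw, ← transpose_stateMatrix_mulVec_lengthsAfter x l (k + 1)]
  exact transpose_stateMatrix_mulVec_lt_winner _ (hpos _) (by simp [hw])

/-- The length vector exists: the simplices of the vectors whose first `k` accelerated steps follow
`x` are nested, nonempty and compact. -/
lemma FinitePath.exists_codes {γ : FinitePath} (hγ : γ.Complete) {x : ℕ → State}
    (hx : x ∈ γ.recurrent) : ∃ l, Codes x l := by
  let K : ℕ → Set (Fin 3 → ℝ) := fun k => stdSimplex ℝ (Fin 3) ∩ {l | ∀ i, 0 ≤ lengthsAfter x l k i}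
  have hclosed : ∀ k, IsClosed (K k) := by
    intro k
    refine (isCompact_stdSimplex ℝ (Fin 3)).isClosed.inter ?_
    simp only [lengthsAfter_eq, Set.ofPred_forall]
    refine isClosed_iInter fun i => isClosed_le continuous_const ?_
    fun_prop
  have hanti : ∀ k, K (k + 1) ⊆ K k := fun k l hl =>
    ⟨hl.1, fun i => (hl.2 i).trans (lengthsAfter_le_of_le k.le_succ hl.2 i)⟩
  have hne : ∀ k, (K k).Nonempty := by
    intro k
    let w : Fin 3 → ℝ := (cocycle x k)ᵀ *ᵥ 1
    have hw : ∀ i, 1 ≤ w i := by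
      intro i
      have h1 : ∀ j ∈ Finset.univ, 0 ≤ cocycle x k j i := fun j _ => cocycle_nonneg x k j i
      calc (1 : ℝ) = (1 : Matrix (Fin 3) (Fin 3) ℝ) i i := by simp
        _ ≤ cocycle x k i i := one_le_cocycle x k i i
        _ ≤ ∑ j, cocycle x k j i := Finset.single_le_sum h1 (Finset.mem_univ i)
        _ = w i := by simp [w, Matrix.mulVec, dotProduct]
    have hs : 0 < ∑ i, w i :=
      Finset.sum_pos (fun i _ => one_pos.trans_le (hw i)) Finset.univ_nonempty
    refine ⟨(∑ i, w i)⁻¹ • w, ⟨fun i => ?_, ?_⟩, fun i => ?_⟩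
    · exact mul_nonneg (inv_nonneg.2 hs.le) (zero_le_one.trans (hw i))
    · simp only [Pi.smul_apply, smul_eq_mul, ← Finset.mul_sum]
      exact inv_mul_cancel₀ hs.ne'
    · rw [← Matrix.mulVec_smul, lengthsAfter_transpose_cocycle_mulVec]
      simpa using hs.le
  obtain ⟨l, hl⟩ := IsCompact.nonempty_iInter_of_sequence_nonempty_isCompact_isClosed K hanti hne
    ((isCompact_stdSimplex ℝ (Fin 3)).of_isClosed_subset (hclosed 0) Set.inter_subset_left) hclosed
  rw [Set.mem_iInter] at hl
  exact ⟨l, γ.codes_of_nonneg hγ hx (hl 0).1.2 fun k => (hl k).2⟩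

lemma FinitePath.codes_lengthVector {γ : FinitePath} (hγ : γ.Complete) {x : ℕ → State}
    (hx : x ∈ γ.recurrent) : Codes x (lengthVector x) :=
  Classical.epsilon_spec (γ.exists_codes hγ hx)

/-! ### First returns and the roof function -/

lemma FinitePath.returnIndex_spec {γ : FinitePath} {x : ℕ → State} (hx : x ∈ γ.recurrent) :
    1 ≤ γ.returnIndex x ∧ shift^[γ.returnIndex x] x ∈ γ.simplex := by
  obtain ⟨n, hn, h⟩ := hx.2 1
  exact Nat.sInf_mem (s := {n | 1 ≤ n ∧ shift^[n] x ∈ γ.simplex}) ⟨n, hn, h⟩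

lemma FinitePath.returnIndex_le {γ : FinitePath} {x : ℕ → State} {n : ℕ} (hn : 1 ≤ n)
    (h : shift^[n] x ∈ γ.simplex) : γ.returnIndex x ≤ n :=
  Nat.sInf_le ⟨hn, h⟩

/-- `e^{-r}` is the total length that is left at the first return. -/
lemma FinitePath.exp_neg_three_mul_roof {γ : FinitePath} (hγ : γ.Complete) {x : ℕ → State}
    (hx : x ∈ γ.recurrent) : Real.exp (-3 * γ.roof x) =
      (∑ i, lengthsAfter x (lengthVector x) (γ.returnIndex x) i) ^ 3 := by
  have hpos := ((γ.codes_lengthVector hγ hx).2 (γ.returnIndex x)).pos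
  have hs := Finset.sum_pos (fun i _ => hpos i) Finset.univ_nonempty
  have habs : ∑ i, |lengthsAfter x (lengthVector x) (γ.returnIndex x) i| =
      ∑ i, lengthsAfter x (lengthVector x) (γ.returnIndex x) i :=
    Finset.sum_congr rfl fun i _ => abs_of_pos (hpos i)
  rw [roof, ← lengthsAfter_eq, habs, neg_mul_neg, mul_comm, Real.exp_mul, Real.exp_log hs]
  norm_cast

/-! ### The Ruelle operator of the shift -/

/-- The second interval of the first accelerated step is the longest one after it, so each of its
`n` ordinary steps removes at least a third of the total length that remains in the end. -/
lemma sum_lengthsAfter_one_le {x : ℕ → State} (hx : x ∈ pathSpace) {l : Fin 3 → ℝ}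
    (hl : Codes x l) : ∑ i, lengthsAfter x l 1 i ≤ 3 / ((x 0).2 : ℕ) := by
  have ho := hl.2 1
  have hn := one_le_count (x 0)
  rw [le_div_iff₀ (by positivity)]
  have hsum := hl.1
  have hstep : l = _ := (transpose_stateMatrix_mulVec_lengthsAfter x l 0).symm
  rw [transpose_stateMatrix_mulVec] at hstep
  have hw := (hx 0).apply_zero
  have hmax := ho.le_winner
  rw [hw] at hmax
  generalize lengthsAfter x l 1 = v at *
  rw [hstep, sum_eq_of_perm (x 0).1] at hsum
  simp only [Function.update_self, ne_eq, EmbeddingLike.apply_eq_iff_eq,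
    one_ne_zero, not_false_eq_true, Function.update_of_ne, Fin.reduceEq] at hsum
  have h0 := ho.pos ((x 0).1 0)
  have h1 := ho.pos ((x 0).1 1)
  have h2 := ho.pos ((x 0).1 2)
  have hv : ∑ i, v i ≤ 3 * v ((x 0).1 1) := by
    rw [sum_eq_of_perm (x 0).1]
    linarith [hmax ((x 0).1 0), hmax ((x 0).1 2)]
  have hnn : 0 ≤ ((x 0).2 : ℕ) * v ((x 0).1 2) := by positivity
  nlinarith [mul_le_mul_of_nonneg_right hv (zero_le_one.trans hn)]

lemma summable_count_div_pow : Summable fun s : State => (3 / ((s.2 : ℕ) : ℝ)) ^ 3 := by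
  have h : Summable fun n : ℕ+ => (3 / ((n : ℕ) : ℝ)) ^ 3 := by
    have := ((Real.summable_nat_pow_inv (p := 3)).2 (by norm_num)).mul_left 27
    refine (this.comp_injective PNat.coe_injective).congr fun n => ?_
    simp only [Function.comp_apply, div_eq_mul_inv, mul_pow, inv_pow]
    norm_num
  have hone : Summable fun _ : Equiv.Perm (Fin 3) => (1 : ℝ) := Summable.of_finite
  simpa using hone.mul_of_nonneg h (fun _ => zero_le_one) fun n => by positivity

lemma ruelleBounded_of_sum_le {Ω : Type*} {X : Set Ω} {F : Ω → Ω} {φ : Ω → ℝ} {C : ℝ}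
    (h : ∀ x ∈ X, ∀ s : Finset {y : Ω // y ∈ X ∧ F y = x}, ∑ y ∈ s, Real.exp (φ y) ≤ C) :
    RuelleBounded X F φ fun _ => 1 := by
  have hnn : ∀ x, 0 ≤ ruelleTerm X F φ (fun _ => 1) x := fun x y =>
    mul_nonneg (Real.exp_pos _).le zero_le_one
  have h' : ∀ x ∈ X, ∀ s, ∑ y ∈ s, ruelleTerm X F φ (fun _ => 1) x y ≤ C := by
    intro x hx s
    simpa [ruelleTerm] using h x hx s
  refine ⟨fun x hx => summable_of_sum_le (hnn x) (h' x hx), C, fun x hx => ?_⟩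
  rw [ruelle, abs_of_nonneg (tsum_nonneg (hnn x))]
  exact (summable_of_sum_le (hnn x) (h' x hx)).tsum_le_of_sum_le (h' x hx)

theorem FinitePath.ruelleBounded_shift {γ : FinitePath} (hγ : γ.Complete) :
    RuelleBounded γ.recurrent shift (fun x => -3 * γ.roof x) fun _ => 1 := by
  refine ruelleBounded_of_sum_le (C := ∑' s : State, (3 / ((s.2 : ℕ) : ℝ)) ^ 3) fun x _ s => ?_
  -- a preimage of `x` under the shift is determined by its first state
  have hinj : Function.Injective
      fun y : {y // y ∈ γ.recurrent ∧ shift y = x} => (y : ℕ → State) 0 := by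
    rintro ⟨y, _, rfl⟩ ⟨z, _, hz⟩ h0
    refine Subtype.ext (funext fun k => ?_)
    cases k with
    | zero => exact h0
    | succ k => exact (congrFun hz k).symm
  have hbound : ∀ y : {y // y ∈ γ.recurrent ∧ shift y = x}, Real.exp (-3 * γ.roof y) ≤
      (3 / ((((y : ℕ → State) 0).2 : ℕ) : ℝ)) ^ 3 := by
    rintro ⟨y, hy, _⟩
    have hc := γ.codes_lengthVector hγ hy
    rw [γ.exp_neg_three_mul_roof hγ hy]
    have hnn := fun i => ((hc.2 (γ.returnIndex y)).pos i).le
    refine pow_le_pow_left₀ (Finset.sum_nonneg fun i _ => hnn i) ?_ 3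
    exact (Finset.sum_le_sum fun i _ => lengthsAfter_le_of_le (γ.returnIndex_spec hy).1 hnn i).trans
      (sum_lengthsAfter_one_le hy.1 hc)
  calc ∑ y ∈ s, Real.exp (-3 * γ.roof y)
      ≤ ∑ y ∈ s, (3 / ((((y : ℕ → State) 0).2 : ℕ) : ℝ)) ^ 3 :=
        Finset.sum_le_sum fun y _ => hbound y
    _ ≤ ∑' y : {y // y ∈ γ.recurrent ∧ shift y = x},
          (3 / ((((y : ℕ → State) 0).2 : ℕ) : ℝ)) ^ 3 :=
        (summable_count_div_pow.comp_injective hinj).sum_le_tsum s fun _ _ => by positivity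
    _ ≤ _ := tsum_comp_le_tsum_of_inj summable_count_div_pow (fun _ => by positivity) hinj

/-! ### Sums of the entries of matrices -/

/-- The sum of all entries, the norm of a matrix with nonnegative entries. -/
def entrySum (A : Matrix (Fin 3) (Fin 3) ℝ) : ℝ := ∑ i, ∑ k, A i k

lemma sum_transpose_mulVec (A : Matrix (Fin 3) (Fin 3) ℝ) (v : Fin 3 → ℝ) :
    ∑ i, (Aᵀ *ᵥ v) i = ∑ i, ∑ k, A i k * v i := by
  simp only [Matrix.mulVec, dotProduct, Matrix.transpose_apply]
  exact Finset.sum_comm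

lemma sum_transpose_mulVec_le {A : Matrix (Fin 3) (Fin 3) ℝ} (hA : ∀ i k, 0 ≤ A i k)
    {v : Fin 3 → ℝ} {s : ℝ} (hv : ∀ i, v i ≤ s) : ∑ i, (Aᵀ *ᵥ v) i ≤ entrySum A * s := by
  rw [sum_transpose_mulVec, entrySum, Finset.sum_mul]
  simp only [Finset.sum_mul]
  exact Finset.sum_le_sum fun i _ => Finset.sum_le_sum fun k _ =>
    mul_le_mul_of_nonneg_left (hv i) (hA i k)

lemma le_sum_transpose_mulVec {A : Matrix (Fin 3) (Fin 3) ℝ} (hA : ∀ i k, 0 ≤ A i k)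
    {v : Fin 3 → ℝ} {s : ℝ} (hv : ∀ i, s ≤ v i) : entrySum A * s ≤ ∑ i, (Aᵀ *ᵥ v) i := by
  rw [sum_transpose_mulVec, entrySum, Finset.sum_mul]
  simp only [Finset.sum_mul]
  exact Finset.sum_le_sum fun i _ => Finset.sum_le_sum fun k _ =>
    mul_le_mul_of_nonneg_left (hv i) (hA i k)

lemma entrySum_mul_le {A B : Matrix (Fin 3) (Fin 3) ℝ} (hA : ∀ i k, 0 ≤ A i k)
    (hB : ∀ i k, 0 ≤ B i k) : entrySum (A * B) ≤ entrySum A * entrySum B := by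
  have h : entrySum (A * B) = ∑ i, ∑ a, A i a * ∑ k, B a k := by
    simp only [entrySum, Matrix.mul_apply, Finset.mul_sum]
    exact Finset.sum_congr rfl fun i _ => Finset.sum_comm
  rw [h, entrySum, Finset.sum_mul]
  simp only [Finset.sum_mul]
  refine Finset.sum_le_sum fun i _ => Finset.sum_le_sum fun a _ =>
    mul_le_mul_of_nonneg_left ?_ (hA i a)
  exact Finset.single_le_sum (f := fun a => ∑ k, B a k)
    (fun a _ => Finset.sum_nonneg fun k _ => hB a k) (Finset.mem_univ a)

lemma one_le_entrySum_cocycle (x : ℕ → State) (m : ℕ) : 1 ≤ entrySum (cocycle x m) := by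
  have h : ∀ i, 0 ≤ ∑ k, cocycle x m i k := fun i =>
    Finset.sum_nonneg fun k _ => cocycle_nonneg x m i k
  calc (1 : ℝ) = (1 : Matrix (Fin 3) (Fin 3) ℝ) 0 0 := by simp
    _ ≤ cocycle x m 0 0 := one_le_cocycle x m 0 0
    _ ≤ ∑ k, cocycle x m 0 k :=
        Finset.single_le_sum (fun k _ => cocycle_nonneg x m 0 k) (Finset.mem_univ 0)
    _ ≤ entrySum (cocycle x m) := Finset.single_le_sum (fun i _ => h i) (Finset.mem_univ 0)

/-! ### Bounded distortion -/

/-- The cocycle matrix `B_γ` of the finite path `γ` itself. -/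
noncomputable def FinitePath.matrix (γ : FinitePath) : Matrix (Fin 3) (Fin 3) ℝ :=
  cocycle (fun k => γ.states.getD k (γ.last, 1)) γ.states.length

lemma FinitePath.cocycle_eq_matrix {γ : FinitePath} {x : ℕ → State} (hx : x ∈ γ.simplex) :
    cocycle x γ.states.length = γ.matrix :=
  cocycle_congr fun k hk => by rw [hx.1 k hk, List.getD_eq_getElem _ _ hk]

/-- The cocycle matrix of the path `δγ`, where `δ` is the path that `x` follows until its first
return to `Δ_γ`. -/
noncomputable def FinitePath.returnMatrix (γ : FinitePath) (x : ℕ → State) :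
    Matrix (Fin 3) (Fin 3) ℝ :=
  cocycle x (γ.returnIndex x + γ.states.length)

lemma FinitePath.one_le_entrySum_returnMatrix (γ : FinitePath) (x : ℕ → State) :
    1 ≤ entrySum (γ.returnMatrix x) :=
  one_le_entrySum_cocycle _ _

/-- Bounded distortion: the vectors of `Δ_γ` have comparable coordinates because `γ` is complete, so
up to a constant that depends on `γ` alone, `e^{-r}` is the inverse of the norm of the matrix of the
path that leads to the first return. -/
lemma FinitePath.sum_lengthsAfter_returnIndex_le {γ : FinitePath} (hγ : γ.Complete) {x : ℕ → State}
    (hx : x ∈ γ.recurrent) {l : Fin 3 → ℝ} (hl : Codes x l) :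
    ∑ i, lengthsAfter x l (γ.returnIndex x) i ≤
      entrySum γ.matrix ^ 2 * (entrySum (γ.returnMatrix x))⁻¹ := by
  have hret := (γ.returnIndex_spec hx).2
  have hN := γ.one_le_entrySum_returnMatrix x
  rw [← div_eq_mul_inv, le_div_iff₀ (by linarith)]
  have hfac : γ.returnMatrix x = γ.matrix * cocycle x (γ.returnIndex x) := by
    rw [returnMatrix, cocycle_add, γ.cocycle_eq_matrix hret]
  have hG : ∀ i k, 0 ≤ γ.matrix i k := cocycle_nonneg _ _
  have hG1 : 1 ≤ entrySum γ.matrix := one_le_entrySum_cocycle _ _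
  have hC := cocycle_nonneg x (γ.returnIndex x)
  have hC1 := one_le_entrySum_cocycle x (γ.returnIndex x)
  have hmul := entrySum_mul_le hG hC
  rw [← hfac] at hmul
  have hl1 := hl.1
  have hu := (hl.2 (γ.returnIndex x + γ.states.length)).pos
  -- every coordinate at the return time exceeds the total length after `γ` has been followed again
  have hlow : ∀ α, ∑ i, lengthsAfter x l (γ.returnIndex x + γ.states.length) i ≤
      lengthsAfter x l (γ.returnIndex x) α :=
    sum_le_lengthsAfter (fun i => (hu i).le) (γ.exists_winner_of_shift hγ hret)
  have hv : lengthsAfter x l (γ.returnIndex x) =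
      γ.matrixᵀ *ᵥ lengthsAfter x l (γ.returnIndex x + γ.states.length) := by
    rw [← lengthsAfter_transpose_cocycle_mulVec x
      (γ.matrixᵀ *ᵥ lengthsAfter x l (γ.returnIndex x + γ.states.length)) (γ.returnIndex x),
      Matrix.mulVec_mulVec, ← Matrix.transpose_mul, ← hfac, returnMatrix,
      transpose_cocycle_mulVec_lengthsAfter]
  have hup : ∑ i, lengthsAfter x l (γ.returnIndex x) i ≤ entrySum γ.matrix *
      ∑ i, lengthsAfter x l (γ.returnIndex x + γ.states.length) i := by
    conv_lhs => rw [hv]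
    exact sum_transpose_mulVec_le hG fun i =>
      Finset.single_le_sum (fun i _ => (hu i).le) (Finset.mem_univ i)
  have hone := le_sum_transpose_mulVec hC hlow
  rw [transpose_cocycle_mulVec_lengthsAfter, hl1] at hone
  have hs : 0 ≤ ∑ i, lengthsAfter x l (γ.returnIndex x + γ.states.length) i :=
    Finset.sum_nonneg fun i _ => (hu i).le
  generalize ∑ i, lengthsAfter x l (γ.returnIndex x + γ.states.length) i = s at *
  generalize entrySum γ.matrix = G at *
  calc (∑ i, lengthsAfter x l (γ.returnIndex x) i) * entrySum (γ.returnMatrix x)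
      ≤ (G * s) * (G * entrySum (cocycle x (γ.returnIndex x))) := by gcongr
    _ = G ^ 2 * (entrySum (cocycle x (γ.returnIndex x)) * s) := by ring
    _ ≤ G ^ 2 * 1 := by gcongr
    _ = G ^ 2 := mul_one _

/-! ### Packing the cells of the first returns -/

/-- The positive vectors in the order `τ` with all coordinates less than `1`. -/
def orderedCube (τ : Equiv.Perm (Fin 3)) : Set (Fin 3 → ℝ) :=
  {u | OrderedBy τ u ∧ u (τ 0) < 1}

lemma isOpen_orderedCube (τ : Equiv.Perm (Fin 3)) : IsOpen (orderedCube τ) := by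
  unfold orderedCube OrderedBy
  refine IsOpen.and (IsOpen.and ?_ (IsOpen.and ?_ ?_)) ?_ <;>
    exact isOpen_lt (by fun_prop) (by fun_prop)

lemma volume_orderedCube_pos (τ : Equiv.Perm (Fin 3)) : 0 < volume (orderedCube τ) := by
  refine (isOpen_orderedCube τ).measure_pos volume ⟨![3 / 4, 1 / 2, 1 / 4] ∘ τ.symm, ?_⟩
  simp [orderedCube, OrderedBy]
  norm_num

lemma orderedCube_subset_Icc (τ : Equiv.Perm (Fin 3)) : orderedCube τ ⊆ Set.Icc 0 1 :=
  fun _ hu => ⟨fun i => (hu.1.pos i).le, fun i => (hu.1.le_winner i).trans hu.2.le⟩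

lemma volume_orderedCube_lt_top (τ : Equiv.Perm (Fin 3)) : volume (orderedCube τ) < ⊤ :=
  (measure_mono (orderedCube_subset_Icc τ)).trans_lt isCompact_Icc.measure_lt_top

/-- A truncated open cone of vectors whose itinerary begins with `δγ`, where `δ` is the path that
`x` follows until its first return to `Δ_γ`. Division by the norm of the matrix of `δγ` keeps it in
the unit cube, so that its volume is proportional to the inverse cube of that norm. -/
noncomputable def FinitePath.cell (γ : FinitePath) (x : ℕ → State) : Set (Fin 3 → ℝ) :=
  Matrix.toLin' ((entrySum (γ.returnMatrix x))⁻¹ • (γ.returnMatrix x)ᵀ) '' orderedCube γ.last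

lemma FinitePath.det_cell_matrix (γ : FinitePath) (x : ℕ → State) :
    LinearMap.det (Matrix.toLin' ((entrySum (γ.returnMatrix x))⁻¹ • (γ.returnMatrix x)ᵀ)) =
      (entrySum (γ.returnMatrix x))⁻¹ ^ 3 := by
  rw [LinearMap.det_toLin', Matrix.det_smul, Matrix.det_transpose, returnMatrix, det_cocycle]
  simp

lemma FinitePath.volume_cell (γ : FinitePath) (x : ℕ → State) :
    volume (γ.cell x) =
      ENNReal.ofReal ((entrySum (γ.returnMatrix x))⁻¹ ^ 3) * volume (orderedCube γ.last) := by
  have hN := γ.one_le_entrySum_returnMatrix x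
  rw [cell, Measure.addHaar_image_linearMap, det_cell_matrix, abs_of_nonneg (by positivity)]

lemma FinitePath.measurableSet_cell (γ : FinitePath) (x : ℕ → State) :
    MeasurableSet (γ.cell x) := by
  have hN := γ.one_le_entrySum_returnMatrix x
  refine (isOpen_orderedCube γ.last).measurableSet.image_of_continuousOn_injOn
    (LinearMap.continuous_of_finiteDimensional _).continuousOn (Function.Injective.injOn ?_)
  refine (LinearMap.equivOfDetNeZero (Matrix.toLin'
    ((entrySum (γ.returnMatrix x))⁻¹ • (γ.returnMatrix x)ᵀ)) ?_).injective
  rw [det_cell_matrix]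
  positivity

lemma FinitePath.cell_subset_Icc (γ : FinitePath) (x : ℕ → State) :
    γ.cell x ⊆ Set.Icc 0 1 := by
  have hN := γ.one_le_entrySum_returnMatrix x
  have hN0 : 0 < entrySum (γ.returnMatrix x) := by linarith
  have hnn : ∀ i k, 0 ≤ γ.returnMatrix x i k := cocycle_nonneg _ _
  rintro _ ⟨u, hu, rfl⟩
  have h01 := orderedCube_subset_Icc _ hu
  have h0 : ∀ i, 0 ≤ ((γ.returnMatrix x)ᵀ *ᵥ u) i := fun i => by
    simp only [Matrix.mulVec, dotProduct, Matrix.transpose_apply]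
    exact Finset.sum_nonneg fun k _ => mul_nonneg (hnn k i) (h01.1 k)
  rw [Matrix.toLin'_apply, Matrix.smul_mulVec]
  refine ⟨fun i => mul_nonneg (by positivity) (h0 i), fun i => ?_⟩
  change (entrySum (γ.returnMatrix x))⁻¹ * ((γ.returnMatrix x)ᵀ *ᵥ u) i ≤ 1
  rw [inv_mul_le_iff₀ hN0]
  calc ((γ.returnMatrix x)ᵀ *ᵥ u) i ≤ ∑ i, ((γ.returnMatrix x)ᵀ *ᵥ u) i :=
        Finset.single_le_sum (fun i _ => h0 i) (Finset.mem_univ i)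
    _ ≤ _ := sum_transpose_mulVec_le hnn h01.2

lemma FinitePath.orderedBy_of_mem_cell {γ : FinitePath} {x : ℕ → State} (hx : x ∈ γ.recurrent)
    {l : Fin 3 → ℝ} (hl : l ∈ γ.cell x) :
    OrderedBy (x (γ.returnIndex x + γ.states.length)).1
      (lengthsAfter x l (γ.returnIndex x + γ.states.length)) := by
  have hN := γ.one_le_entrySum_returnMatrix x
  have hlast := (γ.returnIndex_spec hx).2.2
  rw [shift_iterate_apply] at hlast
  obtain ⟨u, ⟨⟨h1, h2, h3⟩, _⟩, rfl⟩ := hl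
  rw [Matrix.toLin'_apply, Matrix.smul_mulVec, ← Matrix.mulVec_smul, returnMatrix,
    lengthsAfter_transpose_cocycle_mulVec, hlast]
  have hc : 0 < (entrySum (γ.returnMatrix x))⁻¹ := by positivity
  exact ⟨mul_lt_mul_of_pos_left h1 hc, mul_lt_mul_of_pos_left h2 hc, mul_pos hc h3⟩

/-- The cells of different preimages of a point under the first return map are disjoint: if two of
them met, one path until the return would begin with the other one, against the return being the
first. -/
lemma FinitePath.disjoint_cell {γ : FinitePath} {x y : ℕ → State} (hx : x ∈ γ.recurrent)
    (hy : y ∈ γ.recurrent) (hxy : γ.returnMap x = γ.returnMap y) (hne : x ≠ y) :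
    Disjoint (γ.cell x) (γ.cell y) := by
  wlog hle : γ.returnIndex x ≤ γ.returnIndex y generalizing x y
  · exact (this hy hx hxy.symm hne.symm (le_of_not_ge hle)).symm
  rw [Set.disjoint_left]
  intro l hlx hly
  apply hne
  obtain ⟨hagree, hvertex⟩ := eq_of_orderedBy hx.1 hy.1 (Nat.add_le_add_right hle _)
    (γ.orderedBy_of_mem_cell hx hlx) (γ.orderedBy_of_mem_cell hy hly)
  obtain ⟨hpos, hret⟩ := γ.returnIndex_spec hx
  have hret' : shift^[γ.returnIndex x] y ∈ γ.simplex := by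
    refine ⟨fun i hi => ?_, ?_⟩
    · rw [← hret.1 i hi, shift_iterate_apply, shift_iterate_apply, hagree _ (by omega)]
    · rw [← hret.2, shift_iterate_apply, shift_iterate_apply, hvertex]
  have heq := hle.antisymm (γ.returnIndex_le hpos hret')
  funext k
  rcases lt_or_ge k (γ.returnIndex x) with hk | hk
  · exact hagree k (by omega)
  · have := congrFun hxy (k - γ.returnIndex x)
    rwa [returnMap, returnMap, ← heq, shift_iterate_apply, shift_iterate_apply,
      Nat.add_sub_cancel' hk] at this

lemma FinitePath.sum_inv_entrySum_returnMatrix_le (γ : FinitePath) {X : Set (ℕ → State)}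
    (hX : X ⊆ γ.recurrent) {x : ℕ → State} (s : Finset {y // y ∈ X ∧ γ.returnMap y = x}) :
    ∑ y ∈ s, (entrySum (γ.returnMatrix y))⁻¹ ^ 3 ≤ (volume (orderedCube γ.last)).toReal⁻¹ := by
  have hV := ENNReal.toReal_pos (volume_orderedCube_pos γ.last).ne'
    (volume_orderedCube_lt_top γ.last).ne
  have hnn : ∀ y : ℕ → State, 0 ≤ (entrySum (γ.returnMatrix y))⁻¹ ^ 3 := fun y => by
    have := γ.one_le_entrySum_returnMatrix y
    positivity
  have hpack : ∑ y ∈ s, volume (γ.cell y) ≤ 1 := by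
    rw [← measure_biUnion_finset (f := fun y : {y // y ∈ X ∧ γ.returnMap y = x} => γ.cell y)
      (fun y _ z _ hyz => ?_) fun y _ => γ.measurableSet_cell y]
    · have hsub : ⋃ y ∈ s, γ.cell y.1 ⊆ Set.Icc 0 1 :=
        Set.iUnion₂_subset fun y _ => γ.cell_subset_Icc y.1
      refine (measure_mono hsub).trans ?_
      simp [Real.volume_Icc_pi]
    · exact γ.disjoint_cell (hX y.2.1) (hX z.2.1) (y.2.2.trans z.2.2.symm)
        fun h => hyz (Subtype.ext h)
  simp only [volume_cell, ← Finset.sum_mul] at hpack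
  rw [← ENNReal.ofReal_sum_of_nonneg fun y _ => hnn y.1] at hpack
  have := ENNReal.toReal_mono ENNReal.one_ne_top hpack
  rw [ENNReal.toReal_mul, ENNReal.toReal_ofReal (Finset.sum_nonneg fun y _ => hnn y.1),
    ENNReal.toReal_one] at this
  rwa [← one_div, le_div_iff₀ hV]

theorem FinitePath.ruelleBounded_returnMap {γ : FinitePath} (hγ : γ.Complete) :
    RuelleBounded (γ.recurrent ∩ γ.simplex) γ.returnMap (fun x => -3 * γ.roof x) fun _ => 1 := by
  refine ruelleBounded_of_sum_le
    (C := (entrySum γ.matrix ^ 2) ^ 3 * (volume (orderedCube γ.last)).toReal⁻¹) fun x _ s => ?_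
  have hbound : ∀ y ∈ γ.recurrent, Real.exp (-3 * γ.roof y) ≤
      (entrySum γ.matrix ^ 2) ^ 3 * (entrySum (γ.returnMatrix y))⁻¹ ^ 3 := by
    intro y hy
    have hc := γ.codes_lengthVector hγ hy
    rw [γ.exp_neg_three_mul_roof hγ hy, ← mul_pow]
    exact pow_le_pow_left₀ (Finset.sum_nonneg fun i _ => ((hc.2 _).pos i).le)
      (γ.sum_lengthsAfter_returnIndex_le hγ hy hc) 3
  calc ∑ y ∈ s, Real.exp (-3 * γ.roof y)
      ≤ ∑ y ∈ s, (entrySum γ.matrix ^ 2) ^ 3 * (entrySum (γ.returnMatrix y))⁻¹ ^ 3 :=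
        Finset.sum_le_sum fun y _ => hbound y y.2.1.1
    _ = (entrySum γ.matrix ^ 2) ^ 3 * ∑ y ∈ s, (entrySum (γ.returnMatrix y))⁻¹ ^ 3 :=
        (Finset.mul_sum _ _ _).symm
    _ ≤ _ := mul_le_mul_of_nonneg_left
        (γ.sum_inv_entrySum_returnMatrix_le Set.inter_subset_left s) (by positivity)

end RauzyGasket

theorem mainTheorem8 (γ : RauzyGasket.FinitePath) (hγ : γ.Complete) :
    RauzyGasket.RuelleBounded γ.recurrent RauzyGasket.shift
        (fun x => -3 * γ.roof x) (fun _ => 1) ∧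
      RauzyGasket.RuelleBounded (γ.recurrent ∩ γ.simplex) γ.returnMap
        (fun x => -3 * γ.roof x) (fun _ => 1) := by
  exact ⟨γ.ruelleBounded_shift hγ, γ.ruelleBounded_returnMap hγ⟩
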